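/- Let $H$ be a Hermitian operator on a finite-dimensional Hilbert space (e.g. an $n$-qubit Hamiltonian), $\beta\in\mathbb{R}$, and let $\rho_\beta=e^{-\beta H}/\operatorname{tr}(e^{-\beta H})$. For $s\in[0,1]$ put $\langle A,B\rangle_s=\operatorname{tr}(A^\dagger\rho_\beta^{1-s}B\rho_\beta^{s})$. A linear map $\mathcal T$ on operators satisfies $s$-detailed balance if its Hilbert–Schmidt dual $\mathcal T^\dagger$ is self-adjoint with respect to $\langle\cdot,\cdot\rangle_s$. Let $\mathcal N$ be a quantum channel (completely positive trace-preserving map) that satisfies $s$-detailed balance, has $\rho_\beta$ as its unique fixed state and has spectrum contained in $[0,1]$. Let $\mathrm{gap}(\mathcal N)=1-\lambda_2$, where $\lambda_2$ is the largest eigenvalue of $\mathcal N$ other than the (simple) eigenvalue $1$, and let $t_{mix}(\eta)$ be the least $t\in\mathbb N$ such that $\|\mathcal N^t(\sigma)-\rho_\beta\|_1\le\eta$ for all states $\sigma$. Let $\mathcal M(X)=\sum_u O_uXO_u^\dagger$ be a measurement channel with finitely many Kraus operators labelled by real outcomes $u$, $\sum_uO_u^\dagger O_u=I$. Put $$v=\mathbb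 E_{\rho_\beta}(\mathcal M)=\sum_u u\,\operatorname{tr}(O_u\rho_\beta O_u^\dagger),\qquad \mathbb V_{\rho_\beta}(\mathcal M)=\sum_u|u-v|^2\operatorname{tr}(O_u\rho_\beta O_u^\dagger),$$ $$\mathrm{Cov}_{\rho_\beta}(\mathcal M)=\sum_{x,y}(x-v)(y-v)\operatorname{tr}(O_yO_x\rho_\beta O_x^\dagger O_y^\dagger),\qquad \widehat{\mathcal M}(X)=\sum_u(u-v)\,O_uXO_u^\dagger .$$ Suppose that $\mathcal M$ and $\widehat{\mathcal M}$ both satisfy $s$-detailed balance. Let $\rho$ be an arbitrary initial state, $\epsilon,\eta>0$, and let $K\ge1$ be an integer with $$K\;\ge\;\frac{2\,\mathbb V_{\rho_\beta}(\mathcal M)}{\epsilon^2\eta}\left(\frac{p}{\mathrm{gap}(\mathcal N)}+\frac12\right),\qquad p=\frac{\mathrm{Cov}_{\rho_\beta}(\mathcal M)}{\mathbb V_{\rho_\beta}(\mathcal M)}$$ (with $p=0$ if $\mathbb V_{\rho_\beta}(\mathcal M)=0$). Apply $\mathcal N$ to $\rho$ for $T_{burn}=t_{mix}(\eta)$ times;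 then, for $t=1,\dots,K$, apply $\mathcal M$ and record its outcome $e_t$, apply $\mathcal N$, and apply $\mathcal M$ again, discarding the outcome of this second measurement. Then $$\Pr_\rho\left(\left|\frac1K\sum_{t=1}^Ke_t-\mathbb E_{\rho_\beta}(\mathcal M)\right|\ge\epsilon\right)\le 2\eta .$$ -/

import Mathlib

namespace SingleTrajectory

open Matrix
open scoped ComplexOrder

noncomputable section

/-- Linear maps on the space of complex `d × d` matrices. For `n` qubits, `d` has `2 ^ n` elements. -/
abbrev SuperOp (d : Type*) [Fintype d] [DecidableEq d] : Type _ :=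
  Module.End ℂ (Matrix d d ℂ)

/-- Quantum states: positive semidefinite matrices of trace one. -/
def IsState {d : Type*} [Fintype d] [DecidableEq d] (ρ : Matrix d d ℂ) : Prop :=
  ρ.PosSemidef ∧ ρ.trace = 1

/-- The Gibbs state `exp (-β H) / tr (exp (-β H))`. -/
def gibbs {d : Type*} [Fintype d] [DecidableEq d] (H : Matrix d d ℂ) (β : ℝ) : Matrix d d ℂ :=
  (NormedSpace.exp ((-(β : ℂ)) • H)).trace⁻¹ • NormedSpace.exp ((-(β : ℂ)) • H)

/-- The real power `ρ ^ r` of a Hermitian matrix, by functional calculus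
(used only for the positive definite matrix `gibbs H β`). -/
def matPow {d : Type*} [Fintype d] [DecidableEq d] (ρ : Matrix d d ℂ) (r : ℝ) : Matrix d d ℂ :=
  cfc (fun x : ℝ => x ^ r) ρ

/-- The map `X ↦ O X O†`. -/
def conjBy {d : Type*} [Fintype d] [DecidableEq d] (O : Matrix d d ℂ) : SuperOp d where
  toFun X := O * X * Oᴴ
  map_add' X Y := by rw [mul_add, add_mul]
  map_smul' c X := by simp

/-- Quantum channels (completely positive trace-preserving maps), in Kraus form. -/
def IsChannel {d : Type*} [Fintype d] [DecidableEq d] (T : SuperOp d) : Prop :=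
  ∃ (r : ℕ) (Q : Fin r → Matrix d d ℂ), ∑ u, (Q u)ᴴ * Q u = 1 ∧ T = ∑ u, conjBy (Q u)

/-- The Hilbert–Schmidt inner product `tr (A† B)`. -/
def hsInner {d : Type*} [Fintype d] [DecidableEq d] (A B : Matrix d d ℂ) : ℂ :=
  (Aᴴ * B).trace

/-- The dual map `T†` (Heisenberg picture) with respect to the Hilbert–Schmidt inner product.
Its `(i, j)` entry is `⟨E_ij, T† B⟩ = ⟨T E_ij, B⟩`. -/
def dual {d : Type*} [Fintype d] [DecidableEq d] (T : SuperOp d) : SuperOp d where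
  toFun B := Matrix.of fun i j => hsInner (T (Matrix.single i j 1)) B
  map_add' B C := by
    ext i j
    simp [hsInner, mul_add]
  map_smul' c B := by
    ext i j
    simp [hsInner]

/-- The defining property of the dual map. -/
theorem hsInner_dual {d : Type*} [Fintype d] [DecidableEq d] (T : SuperOp d)
    (A B : Matrix d d ℂ) : hsInner A (dual T B) = hsInner (T A) B := by
  have hA : T A = ∑ i, ∑ j, A i j • T (Matrix.single i j 1) := by
    conv_lhs => rw [Matrix.matrix_eq_sum_single A]
    simp only [map_sum]
    refine Finset.sum_congr rfl fun i _ => Finset.sum_congr rfl fun j _ => ?_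
    rw [← map_smul, Matrix.smul_single, smul_eq_mul, mul_one]
  rw [hA]
  simp only [hsInner, dual, LinearMap.coe_mk, AddHom.coe_mk, Matrix.conjTranspose_sum,
    Matrix.conjTranspose_smul, Finset.sum_mul, Matrix.trace_sum, Matrix.smul_mul,
    Matrix.trace_smul]
  rw [Matrix.trace]
  simp only [Matrix.diag_apply, Matrix.mul_apply, Matrix.conjTranspose_apply, Matrix.of_apply,
    smul_eq_mul]
  rw [Finset.sum_comm]

/-- The weighted inner product `⟨A, B⟩_s = tr (A† ρ^(1-s) B ρ^s)`. -/
def weightedInner {d : Type*} [Fintype d] [DecidableEq d] (s : ℝ) (ρ A B : Matrix d d ℂ) : ℂ :=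
  (Aᴴ * matPow ρ (1 - s) * B * matPow ρ s).trace

/-- `s`-detailed balance of a linear map `T` with respect to `ρ`: the dual map `T†` is
self-adjoint for `⟨·,·⟩_s`. -/
def DetailedBalance {d : Type*} [Fintype d] [DecidableEq d] (s : ℝ) (ρ : Matrix d d ℂ)
    (T : SuperOp d) : Prop :=
  ∀ A B : Matrix d d ℂ, weightedInner s ρ A (dual T B) = weightedInner s ρ (dual T A) B

/-- `ρ` is the unique fixed state of `T`. -/
def UniqueFixedState {d : Type*} [Fintype d] [DecidableEq d] (T : SuperOp d)
    (ρ : Matrix d d ℂ) : Prop :=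
  IsState ρ ∧ T ρ = ρ ∧ ∀ σ, IsState σ → T σ = σ → σ = ρ

/-- The spectral gap of a channel with real spectrum and a unique fixed state: one minus the
largest eigenvalue other than `1` (which is then a simple eigenvalue). -/
def gap {d : Type*} [Fintype d] [DecidableEq d] (T : SuperOp d) : ℝ :=
  1 - sSup {x : ℝ | x ≠ 1 ∧ (x : ℂ) ∈ spectrum ℂ T}

/-- The trace norm: the sum of the singular values. -/
def traceNorm {d : Type*} [Fintype d] [DecidableEq d] (A : Matrix d d ℂ) : ℝ :=
  ∑ i, Real.sqrt ((Matrix.isHermitian_conjTranspose_mul_self A).eigenvalues i)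

/-- The mixing time: the least `t` such that `‖N^t(σ) - ρ‖₁ ≤ ε` for every state `σ`. -/
def mixingTime {d : Type*} [Fintype d] [DecidableEq d] (N : SuperOp d) (ρ : Matrix d d ℂ)
    (ε : ℝ) : ℕ :=
  sInf {t : ℕ | ∀ σ, IsState σ → traceNorm ((N ^ t) σ - ρ) ≤ ε}

/-- A quantum measurement with finitely many Kraus operators `O_u`, each carrying a real
outcome (the outcomes need not be distinct). -/
structure Measurement (d ι : Type*) [Fintype d] [DecidableEq d] [Fintype ι] where
  kraus : ι → Matrix d d ℂ
  outcome : ι → ℝ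
  complete : ∑ u, (kraus u)ᴴ * kraus u = 1

namespace Measurement

variable {d ι : Type*} [Fintype d] [DecidableEq d] [Fintype ι]

/-- The channel `X ↦ ∑ u, O_u X O_u†`, in which the outcome is discarded. -/
def channel (M : Measurement d ι) : SuperOp d :=
  ∑ u, conjBy (M.kraus u)

/-- `𝔼_ρ(M)`. -/
def expectation (M : Measurement d ι) (ρ : Matrix d d ℂ) : ℝ :=
  ∑ u, M.outcome u * (conjBy (M.kraus u) ρ).trace.re

/-- `𝕍_ρ(M)`. -/
def variance (M : Measurement d ι) (ρ : Matrix d d ℂ) : ℝ :=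
  ∑ u, |M.outcome u - M.expectation ρ| ^ 2 * (conjBy (M.kraus u) ρ).trace.re

/-- `Cov_ρ(M)`: correlation of the outcomes of two successive applications of `M`. -/
def covariance (M : Measurement d ι) (ρ : Matrix d d ℂ) : ℝ :=
  ∑ x, ∑ y, (M.outcome x - M.expectation ρ) * (M.outcome y - M.expectation ρ) *
    (conjBy (M.kraus y) (conjBy (M.kraus x) ρ)).trace.re

/-- The weighted map `X ↦ ∑ u, (u - 𝔼_ρ(M)) O_u X O_u†`. -/
def hat (M : Measurement d ι) (ρ : Matrix d d ℂ) : SuperOp d :=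
  ∑ u, ((M.outcome u - M.expectation ρ : ℝ) : ℂ) • conjBy (M.kraus u)

/-- The unnormalized state after the rounds of the sampling stage whose recorded Kraus labels,
in chronological order, are `l`, started from `σ`. One round applies `M`, records its label `u`,
then applies `N` and then `M` again with the outcome of that second measurement discarded. -/
def trajectoryState (M : Measurement d ι) (N : SuperOp d) :
    List ι → Matrix d d ℂ → Matrix d d ℂ
  | [], σ => σ
  | u :: l, σ => trajectoryState M N l (M.channel (N (conjBy (M.kraus u) σ)))

/-- The probability that `K` rounds started from `σ` record the labels `x 0, …, x (K - 1)`. -/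
def trajectoryProb (M : Measurement d ι) (N : SuperOp d) (σ : Matrix d d ℂ) {K : ℕ}
    (x : Fin K → ι) : ℝ :=
  (M.trajectoryState N (List.ofFn x) σ).trace.re

/-- The empirical average `(e_1 + ⋯ + e_K) / K` of the recorded outcomes. -/
def empiricalAverage (M : Measurement d ι) {K : ℕ} (x : Fin K → ι) : ℝ :=
  (∑ t, M.outcome (x t)) / K

open Classical in
/-- The probability that, after `T` burn-in applications of `N` to the initial state `ρ` and `K`
rounds of the sampling stage, the empirical average `X_K` satisfies `|X_K - v| ≥ ε`. -/
def deviationProb (M : Measurement d ι) (N : SuperOp d) (ρ : Matrix d d ℂ) (T K : ℕ)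
    (v ε : ℝ) : ℝ :=
  ∑ x : Fin K → ι with ε ≤ |M.empiricalAverage x - v|, M.trajectoryProb N ((N ^ T) ρ) x

end Measurement

end

end SingleTrajectory

namespace SingleTrajectory

open Matrix
open scoped ComplexOrder

noncomputable section

/-! Write r for the stationary state and Γ(B) = r^(1-s) B r^s (`weightMap`). Detailed balance of T
is the intertwining T Γ = Γ T† (`DetailedBalance.apply_weightMap`), and Γ(1) = r, so stationary
quantities become inner products ⟨·,·⟩_s of Heisenberg-picture operators.

Put a = M̂†(1). Then M̂(r) = Γ(a), the covariance is ⟨a, a⟩_s, and the correlation of two recorded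
outcomes j + 1 rounds apart is ⟨a, (M†N†M†)^j M†N† a⟩_s. Centring makes a orthogonal to 1, which M†
and N† both fix. On the complement of 1, M† is a contraction by Kadison–Schwarz and N† contracts by
1 - gap, since uniqueness of the fixed state makes the eigenvalue 1 simple. Hence each correlation
is at most (1 - gap)^(j+1) Cov (`correlation_le`), and their sum is at most Cov / gap.

From the stationary state, the centred sum of K outcomes therefore has second moment at most K (V +
2 Cov / gap), and Chebyshev's inequality bounds the deviation probability by η. Burn-in brings any
initial state within trace norm η of r, which adds at most another η (`deviation_sub_le`). -/

/-! ### Self-adjoint operators -/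

section Symmetric

variable {E : Type*} [NormedAddCommGroup E] [InnerProductSpace ℂ E] [FiniteDimensional ℂ E]

/-- A self-adjoint operator is bounded by `c` on the orthogonal complement of `e` if all its
eigenvectors outside the line of `e` have eigenvalues of modulus at most `c`. -/
theorem norm_apply_le_of_orthogonal {T : E →ₗ[ℂ] E} (hT : T.IsSymmetric) {e : E} {c : ℝ}
    (hc : 0 ≤ c)
    (h : ∀ (μ : ℝ) (x : E), x ≠ 0 → T x = (μ : ℂ) • x → |μ| ≤ c ∨ ∃ z : ℂ, x = z • e)
    {x : E} (hx : inner ℂ e x = 0) : ‖T x‖ ≤ c * ‖x‖ := by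
  set b := hT.eigenvectorBasis rfl
  refine le_of_sq_le_sq ?_ (by positivity)
  rw [mul_pow, ← b.sum_sq_norm_inner_right, ← b.sum_sq_norm_inner_right x, Finset.mul_sum]
  refine Finset.sum_le_sum fun i _ => ?_
  have hb : T (b i) = (hT.eigenvalues rfl i : ℂ) • b i := hT.apply_eigenvectorBasis rfl i
  have h1 : inner ℂ (b i) (T x) = (hT.eigenvalues rfl i : ℂ) * inner ℂ (b i) x := by
    rw [← hT, hb, inner_smul_left]
    simp
  rw [h1, norm_mul, mul_pow]
  -- An eigenvector on the line of `e` escapes the bound, but `x` has no component along it.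
  rcases h _ (b i) (b.orthonormal.ne_zero i) hb with h2 | ⟨z, hz⟩
  · refine mul_le_mul_of_nonneg_right ?_ (by positivity)
    have : ‖(hT.eigenvalues rfl i : ℂ)‖ ≤ c := by simpa using h2
    gcongr
  · rw [hz, inner_smul_left, hx]
    simp

end Symmetric

/-! ### Decay under self-adjoint maps for an abstract inner product -/

section Core

variable {V : Type*} [AddCommGroup V] [Module ℂ V] [FiniteDimensional ℂ V]

/-- Correlations of a self-adjoint contraction `P` and a self-adjoint `Q` with spectral gap decay
geometrically on the orthogonal complement of a common fixed vector. -/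
theorem norm_correlation_le (core : InnerProductSpace.Core ℂ V) {P Q : Module.End ℂ V}
    (hP : ∀ x y, core.inner (P x) y = core.inner x (P y))
    (hQ : ∀ x y, core.inner (Q x) y = core.inner x (Q y))
    {e : V} (hPe : P e = e) (hQe : Q e = e) {c : ℝ} (hc : 0 ≤ c)
    (hP1 : ∀ (μ : ℝ) (x : V), x ≠ 0 → P x = (μ : ℂ) • x → |μ| ≤ 1)
    (hQc : ∀ (μ : ℝ) (x : V), x ≠ 0 → Q x = (μ : ℂ) • x → |μ| ≤ c ∨ ∃ z : ℂ, x = z • e)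
    {a : V} (ha : core.inner e a = 0) (k : ℕ) :
    ‖core.inner a (((P * Q * P) ^ k) (P (Q a)))‖ ≤ c ^ (k + 1) * (core.inner a a).re := by
  let _ : NormedAddCommGroup V := core.toNormedAddCommGroup
  let _ : InnerProductSpace ℂ V := InnerProductSpace.ofCore core.toCore
  have hPs : P.IsSymmetric := hP
  have hQs : Q.IsSymmetric := hQ
  have hPn : ∀ x, inner ℂ e x = 0 → ‖P x‖ ≤ ‖x‖ := fun x hx => by
    simpa using norm_apply_le_of_orthogonal hPs zero_le_one
      (fun μ x h1 h2 => Or.inl (hP1 μ x h1 h2)) hx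
  have hQn : ∀ x, inner ℂ e x = 0 → ‖Q x‖ ≤ c * ‖x‖ := fun x hx =>
    norm_apply_le_of_orthogonal hQs hc hQc hx
  have hPo : ∀ x, inner ℂ e x = 0 → inner ℂ e (P x) = 0 := fun x hx => by
    rw [← hPs, hPe, hx]
  have hQo : ∀ x, inner ℂ e x = 0 → inner ℂ e (Q x) = 0 := fun x hx => by
    rw [← hQs, hQe, hx]
  have ha' : inner ℂ e a = 0 := ha
  -- Orthogonality to `e` is carried along because both bounds hold only on that complement. Only
  -- `Q` contributes a factor `c`: `k` times from the power and once from the initial `Q a`.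
  have key : inner ℂ e (((P * Q * P) ^ k) (P (Q a))) = 0 ∧
      ‖((P * Q * P) ^ k) (P (Q a))‖ ≤ c ^ (k + 1) * ‖a‖ := by
    induction k with
    | zero =>
      refine ⟨by simpa using hPo _ (hQo _ ha'), ?_⟩
      simpa using (hPn _ (hQo _ ha')).trans (hQn _ ha')
    | succ k ih =>
      rw [pow_succ']
      simp only [Module.End.mul_apply]
      set y := ((P * Q * P) ^ k) (P (Q a))
      refine ⟨hPo _ (hQo _ (hPo _ ih.1)), ?_⟩
      calc ‖P (Q (P y))‖ ≤ ‖Q (P y)‖ := hPn _ (hQo _ (hPo _ ih.1))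
        _ ≤ c * ‖P y‖ := hQn _ (hPo _ ih.1)
        _ ≤ c * ‖y‖ := by gcongr; exact hPn _ ih.1
        _ ≤ c * (c ^ (k + 1) * ‖a‖) := by gcongr; exact ih.2
        _ = c ^ (k + 1 + 1) * ‖a‖ := by ring
  calc ‖inner ℂ a (((P * Q * P) ^ k) (P (Q a)))‖
      ≤ ‖a‖ * ‖((P * Q * P) ^ k) (P (Q a))‖ := norm_inner_le_norm _ _
    _ ≤ ‖a‖ * (c ^ (k + 1) * ‖a‖) := by gcongr; exact key.2
    _ = c ^ (k + 1) * (‖a‖ ^ 2) := by ring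
    _ = c ^ (k + 1) * (inner ℂ a a).re := by
      rw [← inner_self_eq_norm_sq (𝕜 := ℂ)]
      rfl

/-- Powers of a self-adjoint operator with spectral gap tend to zero weakly on the orthogonal
complement of its fixed vector. -/
theorem tendsto_functional_pow (core : InnerProductSpace.Core ℂ V) {Q : Module.End ℂ V}
    (hQ : ∀ x y, core.inner (Q x) y = core.inner x (Q y))
    {e : V} (hQe : Q e = e) {c : ℝ} (hc : 0 ≤ c) (hc1 : c < 1)
    (hQc : ∀ (μ : ℝ) (x : V), x ≠ 0 → Q x = (μ : ℂ) • x → |μ| ≤ c ∨ ∃ z : ℂ, x = z • e)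
    {x : V} (hx : core.inner e x = 0) (f : V →ₗ[ℂ] ℂ) :
    Filter.Tendsto (fun t : ℕ => f ((Q ^ t) x)) Filter.atTop (nhds 0) := by
  let _ : NormedAddCommGroup V := core.toNormedAddCommGroup
  let _ : InnerProductSpace ℂ V := InnerProductSpace.ofCore core.toCore
  have hQs : Q.IsSymmetric := hQ
  have hx' : inner ℂ e x = 0 := hx
  have key : ∀ t : ℕ, inner ℂ e ((Q ^ t) x) = 0 ∧ ‖(Q ^ t) x‖ ≤ c ^ t * ‖x‖ := by
    intro t
    induction t with
    | zero => simpa using hx'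
    | succ t ih =>
      rw [pow_succ', Module.End.mul_apply]
      refine ⟨by rw [← hQs, hQe, ih.1], ?_⟩
      calc ‖Q ((Q ^ t) x)‖ ≤ c * ‖(Q ^ t) x‖ := norm_apply_le_of_orthogonal hQs hc hQc ih.1
        _ ≤ c * (c ^ t * ‖x‖) := by gcongr; exact ih.2
        _ = c ^ (t + 1) * ‖x‖ := by ring
  have h0 : Filter.Tendsto (fun t : ℕ => (Q ^ t) x) Filter.atTop (nhds 0) := by
    refine squeeze_zero_norm (fun t => (key t).2) ?_
    simpa using (tendsto_pow_atTop_nhds_zero_of_lt_one hc hc1).mul_const ‖x‖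
  -- Passing to a scalar functional frees the conclusion from the norm induced by `core`.
  have := (f.continuous_of_finiteDimensional.tendsto 0).comp h0
  simpa [Function.comp_def] using this

end Core

/-! ### Hermitian matrices -/

variable {d : Type*} [Fintype d] [DecidableEq d]

theorem trace_cfc {A : Matrix d d ℂ} (hA : A.IsHermitian) (f : ℝ → ℝ) :
    (cfc f A).trace = ((∑ i, f (hA.eigenvalues i) : ℝ) : ℂ) := by
  rw [hA.cfc_eq, Matrix.IsHermitian.cfc, Unitary.conjStarAlgAut_apply, Matrix.trace_mul_comm,
    ← mul_assoc]
  simp [Matrix.trace]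

theorem isHermitian_cfc (A : Matrix d d ℂ) (f : ℝ → ℝ) : (cfc f A).IsHermitian :=
  cfc_predicate f A

theorem posSemidef_cfc {A : Matrix d d ℂ} (hA : A.IsHermitian) {f : ℝ → ℝ}
    (hf : ∀ i, 0 ≤ f (hA.eigenvalues i)) : (cfc f A).PosSemidef := by
  rw [hA.cfc_eq, Matrix.IsHermitian.cfc, Unitary.conjStarAlgAut_apply]
  refine Matrix.PosSemidef.mul_mul_conjTranspose_same (Matrix.PosSemidef.diagonal fun i => ?_) _
  simpa using hf i

theorem continuousOn_spectrum (A : Matrix d d ℂ) (f : ℝ → ℝ) : ContinuousOn f (spectrum ℝ A) :=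
  A.finite_real_spectrum.continuousOn f

/-- Since A†A = A², its eigenvalues are the squares of those of A. They are compared as multisets of
roots of the characteristic polynomial, because the two enumerations need not agree index by index.
-/
theorem traceNorm_eq_sum_abs_eigenvalues {A : Matrix d d ℂ} (hA : A.IsHermitian) :
    traceNorm A = ∑ i, |hA.eigenvalues i| := by
  have h2 : Aᴴ * A = cfc (fun x : ℝ => x ^ 2) A := by
    rw [cfc_pow_id (R := ℝ) A 2 hA.isSelfAdjoint, hA.eq, sq]
  have hch : (Aᴴ * A).charpoly.roots =
      Finset.univ.val.map fun i => (((hA.eigenvalues i) ^ 2 : ℝ) : ℂ) := by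
    rw [h2, hA.charpoly_cfc_eq, Polynomial.roots_prod]
    · simp only [Polynomial.roots_X_sub_C, Multiset.bind_singleton]
      rfl
    · exact Finset.prod_ne_zero_iff.2 fun i _ => Polynomial.X_sub_C_ne_zero _
  rw [(Matrix.isHermitian_conjTranspose_mul_self A).roots_charpoly_eq_eigenvalues] at hch
  have := congrArg (fun m : Multiset ℂ => (m.map fun z => Real.sqrt z.re).sum) hch
  simp only [Multiset.map_map, Function.comp_def, Complex.ofReal_re, Real.sqrt_sq_eq_abs] at this
  exact this

/-- The Jordan decomposition of a Hermitian matrix, with the trace of the positive part bounded by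
the trace norm. -/
theorem exists_posSemidef_sub {A : Matrix d d ℂ} (hA : A.IsHermitian) :
    ∃ B C : Matrix d d ℂ, B.PosSemidef ∧ C.PosSemidef ∧ A = B - C ∧ B.trace.re ≤ traceNorm A := by
  refine ⟨cfc (fun x : ℝ => max x 0) A, cfc (fun x : ℝ => max x 0 - x) A, posSemidef_cfc hA ?_,
    posSemidef_cfc hA ?_, ?_, ?_⟩
  · exact fun i => le_max_right _ _
  · exact fun i => sub_nonneg.2 (le_max_left _ _)
  · rw [← cfc_sub _ _ _ (continuousOn_spectrum _ _) (continuousOn_spectrum _ _)]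
    simp only [sub_sub_cancel]
    exact (cfc_id' ℝ A hA.isSelfAdjoint).symm
  · rw [trace_cfc hA, traceNorm_eq_sum_abs_eigenvalues hA, Complex.ofReal_re]
    exact Finset.sum_le_sum fun i _ => max_le (le_abs_self _) (abs_nonneg _)

/-- Cauchy–Schwarz on the singular values, whose squares sum to tr(A†A). This turns entrywise
convergence into convergence in trace norm. -/
theorem traceNorm_le_sqrt (A : Matrix d d ℂ) :
    traceNorm A ≤ Real.sqrt (Fintype.card d * ∑ i, ∑ j, ‖A i j‖ ^ 2) := by
  set hA := Matrix.isHermitian_conjTranspose_mul_self A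
  have hnn : ∀ i, 0 ≤ hA.eigenvalues i :=
    (Matrix.posSemidef_conjTranspose_mul_self A).eigenvalues_nonneg
  have htr : ∑ i, hA.eigenvalues i = ∑ i, ∑ j, ‖A i j‖ ^ 2 := by
    have h := hA.trace_eq_sum_eigenvalues
    have h' := congrArg Complex.re h
    simp only [Matrix.trace, Matrix.diag_apply, Matrix.mul_apply, Matrix.conjTranspose_apply,
      Complex.re_sum] at h'
    rw [Finset.sum_comm]
    have h3 : ∀ z : ℂ, (star z * z).re = ‖z‖ ^ 2 := fun z => by
      rw [← Complex.normSq_eq_norm_sq, Complex.normSq_apply]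
      simp
    simp only [h3] at h'
    simpa using h'.symm
  refine Real.le_sqrt_of_sq_le ?_
  have := sq_sum_le_card_mul_sum_sq (s := Finset.univ)
    (f := fun i => Real.sqrt (hA.eigenvalues i))
  simp only [Real.sq_sqrt (hnn _), htr, Finset.card_univ] at this
  exact this

/-- A positive definite matrix stays positive semidefinite under small Hermitian perturbations. -/
theorem exists_pos_posSemidef_add_smul {ρ X : Matrix d d ℂ} (hρ : ρ.PosDef) (hX : X.IsHermitian) :
    ∃ t : ℝ, 0 < t ∧ (ρ + (t : ℂ) • X).PosSemidef := by
  obtain ⟨m, hm, hm'⟩ : ∃ m : ℝ, 0 < m ∧ ∀ i, m ≤ hρ.1.eigenvalues i := by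
    obtain ⟨m, hm, h⟩ := Pi.exists_forall_pos_add_lt (x := fun _ => (0 : ℝ)) hρ.eigenvalues_pos
    exact ⟨m, hm, fun i => by linarith [h i]⟩
  obtain ⟨c, hc, hc'⟩ : ∃ c : ℝ, 0 < c ∧ ∀ i, -c ≤ hX.eigenvalues i := by
    refine ⟨1 + ∑ i, |hX.eigenvalues i|, by positivity, fun i => ?_⟩
    have := Finset.single_le_sum (fun i _ => abs_nonneg (hX.eigenvalues i)) (Finset.mem_univ i)
    linarith [neg_abs_le (hX.eigenvalues i)]
  have h1 : (cfc (fun x : ℝ => x - m) ρ).PosSemidef :=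
    posSemidef_cfc hρ.1 fun i => sub_nonneg.2 (hm' i)
  have h2 : (cfc (fun x : ℝ => x + c) X).PosSemidef :=
    posSemidef_cfc hX fun i => by linarith [hc' i]
  rw [cfc_sub _ _ _ (continuousOn_spectrum _ _) (continuousOn_spectrum _ _),
    cfc_const m ρ hρ.1.isSelfAdjoint, cfc_id' ℝ ρ hρ.1.isSelfAdjoint] at h1
  rw [cfc_add _ _ _ (continuousOn_spectrum _ _) (continuousOn_spectrum _ _),
    cfc_const c X hX.isSelfAdjoint, cfc_id' ℝ X hX.isSelfAdjoint] at h2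
  -- With ρ - m ≥ 0 and X + c ≥ 0, the constants cancel in ρ + (m/c) X = (ρ - m) + (m/c)(X + c).
  refine ⟨m / c, by positivity, ?_⟩
  have h3 := h1.add (h2.smul (a := ((m / c : ℝ) : ℂ)) (by exact_mod_cast (by positivity)))
  convert h3 using 1
  have h4 : (algebraMap ℝ (Matrix d d ℂ) m) =
      ((m / c : ℝ) : ℂ) • algebraMap ℝ (Matrix d d ℂ) c := by
    have : (c : ℂ) ≠ 0 := by exact_mod_cast hc.ne'
    ext i j
    simp [Matrix.algebraMap_matrix_apply, this]
  rw [smul_add, h4]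
  abel

/-! ### Powers of a positive definite matrix -/

theorem isHermitian_matPow (ρ : Matrix d d ℂ) (r : ℝ) : (matPow ρ r).IsHermitian :=
  isHermitian_cfc _ _

theorem matPow_mul {ρ : Matrix d d ℂ} (hρ : ρ.PosDef) (r t : ℝ) :
    matPow ρ r * matPow ρ t = matPow ρ (r + t) := by
  rw [matPow, matPow, matPow, ← cfc_mul _ _ _ (continuousOn_spectrum _ _)
    (continuousOn_spectrum _ _)]
  refine cfc_congr fun x hx => ?_
  rw [hρ.1.spectrum_real_eq_range_eigenvalues] at hx
  obtain ⟨i, rfl⟩ := hx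
  exact (Real.rpow_add (hρ.eigenvalues_pos i) _ _).symm

theorem matPow_zero {ρ : Matrix d d ℂ} (hρ : ρ.IsHermitian) : matPow ρ 0 = 1 := by
  simp only [matPow, Real.rpow_zero]
  exact cfc_const_one ℝ ρ hρ.isSelfAdjoint

theorem matPow_one {ρ : Matrix d d ℂ} (hρ : ρ.IsHermitian) : matPow ρ 1 = ρ := by
  simp only [matPow, Real.rpow_one]
  exact cfc_id' ℝ ρ hρ.isSelfAdjoint

theorem matPow_neg_mul {ρ : Matrix d d ℂ} (hρ : ρ.PosDef) (r : ℝ) :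
    matPow ρ (-r) * matPow ρ r = 1 := by
  rw [matPow_mul hρ, neg_add_cancel, matPow_zero hρ.1]

theorem matPow_mul_neg {ρ : Matrix d d ℂ} (hρ : ρ.PosDef) (r : ℝ) :
    matPow ρ r * matPow ρ (-r) = 1 := by
  rw [matPow_mul hρ, add_neg_cancel, matPow_zero hρ.1]

theorem matPow_half_mul {ρ : Matrix d d ℂ} (hρ : ρ.PosDef) (r : ℝ) :
    matPow ρ (r / 2) * matPow ρ (r / 2) = matPow ρ r := by
  rw [matPow_mul hρ, add_halves]

/-! ### The Hilbert–Schmidt inner product and the dual map -/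

theorem hsInner_conj (A B : Matrix d d ℂ) : star (hsInner A B) = hsInner B A := by
  rw [hsInner, hsInner, ← Matrix.trace_conjTranspose, Matrix.conjTranspose_mul,
    Matrix.conjTranspose_conjTranspose]

theorem hsInner_single (i j : d) (B : Matrix d d ℂ) :
    hsInner (Matrix.single i j 1) B = B i j := by
  simp [hsInner, Matrix.trace_single_mul]

theorem ext_hsInner {B C : Matrix d d ℂ} (h : ∀ A, hsInner A B = hsInner A C) : B = C := by
  ext i j
  simpa only [hsInner_single] using h (Matrix.single i j 1)

theorem trace_eq_hsInner (T : SuperOp d) (X : Matrix d d ℂ) :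
    (T X).trace = star (hsInner X (dual T 1)) := by
  rw [hsInner_dual, hsInner_conj]
  simp [hsInner]

theorem dual_sum_conjBy {κ : Type*} [Fintype κ] (Q : κ → Matrix d d ℂ) (B : Matrix d d ℂ) :
    dual (∑ u, conjBy (Q u)) B = ∑ u, (Q u)ᴴ * B * Q u := by
  refine ext_hsInner fun A => ?_
  rw [hsInner_dual]
  simp only [hsInner, conjBy, LinearMap.sum_apply, LinearMap.coe_mk, AddHom.coe_mk,
    Matrix.conjTranspose_sum, Matrix.conjTranspose_mul, Matrix.conjTranspose_conjTranspose,
    Finset.sum_mul, Finset.mul_sum, Matrix.trace_sum]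
  refine Finset.sum_congr rfl fun u _ => ?_
  rw [mul_assoc (Q u), Matrix.trace_mul_comm (Q u)]
  simp only [mul_assoc]

/-! ### The weighted inner product -/

/-- The map `B ↦ ρ^(1-s) B ρ^s`. -/
def weightMap (s : ℝ) (ρ : Matrix d d ℂ) : SuperOp d where
  toFun B := matPow ρ (1 - s) * B * matPow ρ s
  map_add' X Y := by rw [mul_add, add_mul]
  map_smul' c X := by simp

theorem weightMap_apply (s : ℝ) (ρ B : Matrix d d ℂ) :
    weightMap s ρ B = matPow ρ (1 - s) * B * matPow ρ s := rfl

theorem weightedInner_eq_hsInner (s : ℝ) (ρ A B : Matrix d d ℂ) :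
    weightedInner s ρ A B = hsInner A (weightMap s ρ B) := by
  simp [weightedInner, hsInner, weightMap_apply, mul_assoc]

theorem weightMap_one {ρ : Matrix d d ℂ} (hρ : ρ.PosDef) (s : ℝ) : weightMap s ρ 1 = ρ := by
  rw [weightMap_apply, mul_one, matPow_mul hρ, sub_add_cancel, matPow_one hρ.1]

theorem weightMap_injective {ρ : Matrix d d ℂ} (hρ : ρ.PosDef) (s : ℝ) :
    Function.Injective (weightMap s ρ) := by
  intro A B h
  have h' := congrArg (fun X => matPow ρ (-(1 - s)) * X * matPow ρ (-s)) h
  have key : ∀ X, matPow ρ (-(1 - s)) * weightMap s ρ X * matPow ρ (-s) = X := fun X => by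
    rw [weightMap_apply, mul_assoc, mul_assoc (_ * X), matPow_mul_neg hρ, mul_one, ← mul_assoc,
      matPow_neg_mul hρ, one_mul]
  simpa only [key] using h'

theorem weightMap_surjective {ρ : Matrix d d ℂ} (hρ : ρ.PosDef) (s : ℝ) :
    Function.Surjective (weightMap s ρ) :=
  LinearMap.injective_iff_surjective.1 (weightMap_injective hρ s)

/-- Splitting each power in half and using cyclicity of the trace exhibits the weighted form as a
pullback of the Hilbert–Schmidt one, so symmetry and positivity are inherited. -/
theorem weightedInner_eq_hsInner_half {ρ : Matrix d d ℂ} (hρ : ρ.PosDef) (s : ℝ)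
    (A B : Matrix d d ℂ) :
    weightedInner s ρ A B =
      hsInner (matPow ρ ((1 - s) / 2) * A * matPow ρ (s / 2))
        (matPow ρ ((1 - s) / 2) * B * matPow ρ (s / 2)) := by
  rw [weightedInner, ← matPow_half_mul hρ (1 - s), ← matPow_half_mul hρ s, hsInner]
  simp only [Matrix.conjTranspose_mul, (isHermitian_matPow ρ _).eq]
  rw [← mul_assoc, Matrix.trace_mul_comm]
  simp only [mul_assoc]

/-- The weighted inner product as an inner product structure. -/
@[reducible]
def weightedCore {ρ : Matrix d d ℂ} (hρ : ρ.PosDef) (s : ℝ) :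
    InnerProductSpace.Core ℂ (Matrix d d ℂ) where
  inner := weightedInner s ρ
  conj_inner_symm A B := by
    rw [weightedInner_eq_hsInner_half hρ, weightedInner_eq_hsInner_half hρ]
    exact hsInner_conj _ _
  re_inner_nonneg A := by
    rw [weightedInner_eq_hsInner_half hρ]
    exact (Complex.nonneg_iff.1 (Matrix.posSemidef_conjTranspose_mul_self _).trace_nonneg).1
  add_left A B C := by simp [weightedInner, add_mul]
  smul_left A B r := by simp [weightedInner]
  definite A h := by
    rw [weightedInner_eq_hsInner_half hρ, hsInner,
      Matrix.trace_conjTranspose_mul_self_eq_zero_iff] at h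
    have h' := congrArg (fun X => matPow ρ (-((1 - s) / 2)) * X * matPow ρ (-(s / 2))) h
    simp only [mul_zero, zero_mul] at h'
    rw [mul_assoc, mul_assoc _ (matPow ρ (s / 2)), matPow_mul_neg hρ, mul_one, ← mul_assoc,
      matPow_neg_mul hρ, one_mul] at h'
    exact h'

theorem weightedCore_inner {ρ : Matrix d d ℂ} (hρ : ρ.PosDef) (s : ℝ) (A B : Matrix d d ℂ) :
    (weightedCore hρ s).inner A B = weightedInner s ρ A B := rfl

/-- Self-adjointness of T† read through the nondegenerate Hilbert–Schmidt pairing. This is the form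
in which detailed balance moves computations from states to observables. -/
theorem DetailedBalance.apply_weightMap {s : ℝ} {ρ : Matrix d d ℂ} {T : SuperOp d}
    (hT : DetailedBalance s ρ T) (B : Matrix d d ℂ) :
    T (weightMap s ρ B) = weightMap s ρ (dual T B) := by
  refine ext_hsInner fun A => ?_
  rw [← weightedInner_eq_hsInner, hT, weightedInner_eq_hsInner, ← hsInner_conj, ← hsInner_dual,
    hsInner_conj]

theorem trace_weightMap (s : ℝ) (ρ B : Matrix d d ℂ) :
    (weightMap s ρ B).trace = weightedInner s ρ 1 B := by
  simp [weightedInner_eq_hsInner, hsInner]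

/-! ### Channels -/

theorem IsChannel.dual_one {T : SuperOp d} (hT : IsChannel T) : dual T 1 = 1 := by
  obtain ⟨r, Q, h, rfl⟩ := hT
  simpa [dual_sum_conjBy] using h

theorem IsChannel.trace_apply {T : SuperOp d} (hT : IsChannel T) (X : Matrix d d ℂ) :
    (T X).trace = X.trace := by
  rw [trace_eq_hsInner, hT.dual_one, hsInner_conj]
  simp [hsInner]

theorem conjBy_apply (O X : Matrix d d ℂ) : conjBy O X = O * X * Oᴴ := rfl

theorem posSemidef_conjBy {X : Matrix d d ℂ} (hX : X.PosSemidef) (O : Matrix d d ℂ) :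
    (conjBy O X).PosSemidef :=
  hX.mul_mul_conjTranspose_same O

theorem IsChannel.posSemidef_apply {T : SuperOp d} (hT : IsChannel T) {X : Matrix d d ℂ}
    (hX : X.PosSemidef) : (T X).PosSemidef := by
  obtain ⟨r, Q, h, rfl⟩ := hT
  rw [LinearMap.sum_apply]
  exact Matrix.posSemidef_sum _ fun u _ => posSemidef_conjBy hX _

theorem IsChannel.conjTranspose_apply {T : SuperOp d} (hT : IsChannel T) (X : Matrix d d ℂ) :
    T Xᴴ = (T X)ᴴ := by
  obtain ⟨r, Q, h, rfl⟩ := hT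
  simp [LinearMap.sum_apply, conjBy_apply, Matrix.conjTranspose_sum, mul_assoc]

theorem IsChannel.isState_pow_apply {T : SuperOp d} (hT : IsChannel T) {σ : Matrix d d ℂ}
    (hσ : IsState σ) (t : ℕ) : IsState ((T ^ t) σ) := by
  induction t with
  | zero => simpa using hσ
  | succ t ih =>
    rw [pow_succ', Module.End.mul_apply]
    exact ⟨hT.posSemidef_apply ih.1, by rw [hT.trace_apply, ih.2]⟩

theorem DetailedBalance.apply_eq_self {s : ℝ} {ρ : Matrix d d ℂ} {T : SuperOp d}
    (hρ : ρ.PosDef) (hT : DetailedBalance s ρ T) (hT1 : dual T 1 = 1) : T ρ = ρ := by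
  have := hT.apply_weightMap 1
  rwa [hT1, weightMap_one hρ] at this

/-- Real eigenvalues of the dual of a channel with a faithful fixed state lie in `[-1, 1]`, by the
Kadison–Schwarz inequality. -/
theorem IsChannel.abs_eigenvalue_dual_le_one {T : SuperOp d} (hT : IsChannel T)
    {ρ : Matrix d d ℂ} (hρ : ρ.PosDef) (hfix : T ρ = ρ) {μ : ℝ} {X : Matrix d d ℂ} (hX : X ≠ 0)
    (h : dual T X = (μ : ℂ) • X) : |μ| ≤ 1 := by
  have hstat : ∀ Y, (ρ * dual T Y).trace = (ρ * Y).trace := fun Y => by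
    have := hsInner_dual T ρ Y
    rwa [hfix, hsInner, hsInner, hρ.1.eq] at this
  -- At s = 1 the weighted form is tr(X†Xρ), so its definiteness gives strict positivity.
  have hpos : 0 < (ρ * (Xᴴ * X)).trace.re := by
    have h1 : (X * ρ * Xᴴ).trace ≠ 0 := fun h0 => hX <| (weightedCore hρ 1).definite X <| by
      rw [weightedCore_inner, weightedInner, sub_self, matPow_zero hρ.1, matPow_one hρ.1, mul_one,
        mul_assoc, Matrix.trace_mul_comm]
      exact h0
    have h2 := Complex.nonneg_iff.1 (hρ.posSemidef.mul_mul_conjTranspose_same X).trace_nonneg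
    rw [mul_assoc, Matrix.trace_mul_comm, mul_assoc] at h1 h2
    refine lt_of_le_of_ne h2.1 fun h0 => h1 (Complex.ext h0.symm h2.2.symm)
  have hK : μ ^ 2 * (ρ * (Xᴴ * X)).trace.re ≤ (ρ * dual T (Xᴴ * X)).trace.re := by
    obtain ⟨r, Q, hQ, rfl⟩ := hT
    -- The Kadison–Schwarz defect T†(X†X) - T†(X)†T†(X) at an eigenvector, written as a sum of
    -- squares. Pairing it with the stationary ρ will give μ² ≤ 1.
    have hW : dual (∑ u, conjBy (Q u)) (Xᴴ * X) - ((μ ^ 2 : ℝ) : ℂ) • (Xᴴ * X) =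
        ∑ u, (X * Q u - Q u * ((μ : ℂ) • X))ᴴ * (X * Q u - Q u * ((μ : ℂ) • X)) := by
      have e1 : ∀ u, (X * Q u - Q u * ((μ : ℂ) • X))ᴴ * (X * Q u - Q u * ((μ : ℂ) • X)) =
          (Q u)ᴴ * (Xᴴ * X) * Q u - (μ : ℂ) • (((Q u)ᴴ * Xᴴ * Q u) * X)
            - (μ : ℂ) • (Xᴴ * ((Q u)ᴴ * X * Q u))
            + ((μ ^ 2 : ℝ) : ℂ) • (Xᴴ * ((Q u)ᴴ * Q u) * X) := fun u => by
        simp only [Matrix.conjTranspose_sub, Matrix.conjTranspose_mul, Matrix.conjTranspose_smul,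
          RCLike.star_def, Complex.conj_ofReal, mul_sub, sub_mul, mul_assoc, Matrix.mul_smul,
          Matrix.smul_mul, Complex.ofReal_pow]
        module
      have hX' : ∑ u, (Q u)ᴴ * X * Q u = (μ : ℂ) • X := by rw [← h, dual_sum_conjBy]
      have hX'' : ∑ u, (Q u)ᴴ * Xᴴ * Q u = (μ : ℂ) • Xᴴ := by
        have := congrArg Matrix.conjTranspose hX'
        simpa [Matrix.conjTranspose_sum, mul_assoc, -Complex.coe_smul] using this
      simp only [e1, Finset.sum_add_distrib, Finset.sum_sub_distrib, ← Finset.smul_sum,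
        ← Finset.sum_mul, ← Finset.mul_sum, hQ, hX', hX'', dual_sum_conjBy]
      simp only [Matrix.mul_smul, Matrix.smul_mul, mul_one, Complex.ofReal_pow]
      module
    have hnn : 0 ≤ (ρ * (dual (∑ u, conjBy (Q u)) (Xᴴ * X) -
        ((μ ^ 2 : ℝ) : ℂ) • (Xᴴ * X))).trace.re := by
      rw [hW, Finset.mul_sum, Matrix.trace_sum, Complex.re_sum]
      refine Finset.sum_nonneg fun u _ => ?_
      have := (hρ.posSemidef.mul_mul_conjTranspose_same
        (X * Q u - Q u * ((μ : ℂ) • X))).trace_nonneg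
      rw [mul_assoc, Matrix.trace_mul_comm, mul_assoc] at this
      exact (Complex.nonneg_iff.1 this).1
    rw [mul_sub, Matrix.trace_sub, Complex.sub_re, Matrix.mul_smul, Matrix.trace_smul, smul_eq_mul,
      Complex.re_ofReal_mul] at hnn
    linarith
  rw [hstat] at hK
  have : μ ^ 2 ≤ 1 := by
    by_contra hlt
    push Not at hlt
    nlinarith
  exact (sq_le_one_iff_abs_le_one μ).1 this

/-- A channel with a unique fixed state that is faithful has a one-dimensional fixed space. -/
theorem IsChannel.exists_smul_of_apply_eq {T : SuperOp d} (hT : IsChannel T) {ρ : Matrix d d ℂ}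
    (hρ : ρ.PosDef) (hu : UniqueFixedState T ρ) {X : Matrix d d ℂ} (hX : T X = X) :
    ∃ z : ℂ, X = z • ρ := by
  -- For small t > 0 the fixed point ρ + tY is still positive semidefinite. Either it vanishes, or
  -- its normalisation is a fixed state and hence equals ρ.
  have herm : ∀ Y : Matrix d d ℂ, Y.IsHermitian → T Y = Y → ∃ z : ℂ, Y = z • ρ := by
    intro Y hY hTY
    obtain ⟨t, ht, hps⟩ := exists_pos_posSemidef_add_smul hρ hY
    have htc : (t : ℂ) ≠ 0 := by exact_mod_cast ht.ne'
    obtain ⟨c, hc, hc'⟩ : ∃ c : ℝ, 0 ≤ c ∧ (ρ + (t : ℂ) • Y).trace = c := by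
      have h := Complex.nonneg_iff.1 hps.trace_nonneg
      exact ⟨_, h.1, Complex.ext rfl h.2.symm⟩
    suffices h : ρ + (t : ℂ) • Y = (c : ℂ) • ρ by
      refine ⟨(t : ℂ)⁻¹ * (c - 1), ?_⟩
      have h' : (t : ℂ) • Y = ((c : ℂ) - 1) • ρ := by
        rw [sub_smul, one_smul, ← h, add_sub_cancel_left]
      rw [mul_smul, ← h', smul_smul, inv_mul_cancel₀ htc, one_smul]
    rcases hc.eq_or_lt with rfl | hc
    · rw [Complex.ofReal_zero, hps.trace_eq_zero_iff] at hc'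
      simpa using hc'
    · have hcc : (c : ℂ) ≠ 0 := by exact_mod_cast hc.ne'
      have hst : IsState ((c : ℂ)⁻¹ • (ρ + (t : ℂ) • Y)) := by
        refine ⟨hps.smul ?_, ?_⟩
        · exact_mod_cast (inv_pos.2 hc).le
        · rw [Matrix.trace_smul, hc', smul_eq_mul, inv_mul_cancel₀ hcc]
      have := hu.2.2 _ hst (by rw [map_smul, map_add, map_smul, hTY, hu.2.1])
      rw [← this, smul_smul, mul_inv_cancel₀ hcc, one_smul, this]
  -- T commutes with the adjoint, so the Hermitian and anti-Hermitian parts of X are fixed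
  -- separately.
  obtain ⟨z, hz⟩ := herm (X + Xᴴ) (Matrix.isHermitian_add_transpose_self X)
    (by rw [map_add, hT.conjTranspose_apply, hX])
  obtain ⟨w, hw⟩ := herm (Complex.I • (X - Xᴴ))
    (by simp [Matrix.IsHermitian, smul_sub, neg_add_eq_sub])
    (by rw [map_smul, map_sub, hT.conjTranspose_apply, hX])
  refine ⟨(1 / 2) * (z - Complex.I * w), ?_⟩
  have h1 : X = (1 / 2 : ℂ) • ((X + Xᴴ) - Complex.I • (Complex.I • (X - Xᴴ))) := by
    rw [smul_smul, Complex.I_mul_I]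
    module
  rw [h1, hz, hw]
  module

/-! ### The Gibbs state and the spectral gap -/

/-- Semidefiniteness is part of being a state, so invertibility suffices. The exponential is a unit,
and a vanishing scalar would contradict trace one. -/
theorem posDef_gibbs {H : Matrix d d ℂ} {β : ℝ} (h : IsState (gibbs H β)) :
    (gibbs H β).PosDef := by
  rw [h.1.posDef_iff_isUnit, gibbs]
  have hne : (NormedSpace.exp ((-(β : ℂ)) • H)).trace⁻¹ ≠ 0 := fun h0 => by
    have := h.2
    rw [gibbs, h0] at this
    simp at this
  exact (Matrix.isUnit_exp _).smul (Units.mk0 _ hne)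

/-- The spectrum is finite, so the supremum over eigenvalues other than 1 is attained and is below
1. If there are none, `sSup ∅ = 0` makes the gap 1. -/
theorem gap_bounds {N : SuperOp d}
    (hNspec : spectrum ℂ N ⊆ (fun x : ℝ => (x : ℂ)) '' Set.Icc (0 : ℝ) 1) :
    0 < gap N ∧ gap N ≤ 1 ∧ ∀ μ : ℝ, (μ : ℂ) ∈ spectrum ℂ N → μ ≠ 1 → |μ| ≤ 1 - gap N := by
  set S := {x : ℝ | x ≠ 1 ∧ (x : ℂ) ∈ spectrum ℂ N} with hS
  have hI : ∀ x : ℝ, (x : ℂ) ∈ spectrum ℂ N → 0 ≤ x ∧ x ≤ 1 := fun x hx => by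
    obtain ⟨y, hy, hyx⟩ := hNspec hx
    obtain rfl : y = x := Complex.ofReal_injective hyx
    exact hy
  have hfin : S.Finite :=
    ((Module.End.finite_spectrum N).preimage Complex.ofReal_injective.injOn).subset
      fun x hx => hx.2
  have hg : gap N = 1 - sSup S := rfl
  have h0 : 0 ≤ sSup S := Real.sSup_nonneg fun x hx => (hI x hx.2).1
  refine ⟨?_, by linarith, fun μ hμ hμ1 => ?_⟩
  · rw [hg, sub_pos]
    rcases S.eq_empty_or_nonempty with h | h
    · simp [h]
    · have hm := h.csSup_mem hfin
      exact lt_of_le_of_ne (hI _ hm.2).2 hm.1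
  · rw [abs_of_nonneg (hI μ hμ).1, hg, sub_sub_cancel]
    exact le_csSup hfin.bddAbove ⟨hμ1, hμ⟩

/-- Γ carries eigenvectors of N† injectively to eigenvectors of N with the same eigenvalue. The
fixed space of N is the line of ρ = Γ(1), which pulls back to the line of 1. -/
theorem abs_eigenvalue_dual_le_or {N : SuperOp d} {ρ : Matrix d d ℂ} {s : ℝ} (hρ : ρ.PosDef)
    (hN : IsChannel N) (hdb : DetailedBalance s ρ N) (hu : UniqueFixedState N ρ)
    (hNspec : spectrum ℂ N ⊆ (fun x : ℝ => (x : ℂ)) '' Set.Icc (0 : ℝ) 1)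
    (μ : ℝ) (X : Matrix d d ℂ) (hX : X ≠ 0) (h : dual N X = (μ : ℂ) • X) :
    |μ| ≤ 1 - gap N ∨ ∃ z : ℂ, X = z • (1 : Matrix d d ℂ) := by
  have hw : N (weightMap s ρ X) = (μ : ℂ) • weightMap s ρ X := by
    rw [hdb.apply_weightMap, h, map_smul]
  have hw0 : weightMap s ρ X ≠ 0 := fun h0 =>
    hX (weightMap_injective hρ s (by rw [h0, map_zero]))
  by_cases hμ : μ = 1
  · right
    rw [hμ, Complex.ofReal_one, one_smul] at hw
    obtain ⟨z, hz⟩ := hN.exists_smul_of_apply_eq hρ hu hw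
    refine ⟨z, weightMap_injective hρ s ?_⟩
    rw [hz, map_smul, weightMap_one hρ]
  · left
    refine (gap_bounds hNspec).2.2 μ ?_ hμ
    exact (Module.End.hasEigenvalue_of_hasEigenvector
      (Module.End.hasEigenvector_iff.2 ⟨Module.End.mem_eigenspace_iff.2 hw, hw0⟩)).mem_spectrum

/-- Factor σ = B†B. The squared column norms of B are the diagonal entries of σ, hence at most 1,
and an entry of σ is an inner product of two columns. -/
theorem norm_apply_le_one_of_isState {σ : Matrix d d ℂ} (hσ : IsState σ) (i j : d) :
    ‖σ i j‖ ≤ 1 := by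
  obtain ⟨hσ, htr⟩ := hσ
  have hdiag : ∀ k, (σ k k).re ≤ 1 := fun k => by
    have h := congrArg Complex.re htr
    rw [Matrix.trace, Complex.re_sum, Complex.one_re] at h
    rw [← h]
    exact Finset.single_le_sum (f := fun k => (σ k k).re)
      (fun k _ => (Complex.nonneg_iff.1 hσ.diag_nonneg).1) (Finset.mem_univ k)
  obtain ⟨B, rfl⟩ : ∃ B : Matrix d d ℂ, σ = Bᴴ * B := by
    refine ⟨cfc Real.sqrt σ, ?_⟩
    rw [(isHermitian_cfc σ _).eq, ← cfc_mul _ _ _ (continuousOn_spectrum _ _)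
      (continuousOn_spectrum _ _)]
    conv_lhs => rw [← cfc_id' ℝ σ hσ.1.isSelfAdjoint]
    refine cfc_congr fun x hx => ?_
    rw [hσ.1.spectrum_real_eq_range_eigenvalues] at hx
    obtain ⟨i, rfl⟩ := hx
    exact (Real.mul_self_sqrt (hσ.eigenvalues_nonneg i)).symm
  have hB : ∀ k, ∑ l, ‖B l k‖ ^ 2 ≤ 1 := fun k => by
    have h := hdiag k
    simp only [Matrix.mul_apply, Matrix.conjTranspose_apply, Complex.re_sum] at h
    convert h using 2 with l
    rw [← Complex.normSq_eq_norm_sq, Complex.normSq_apply]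
    simp
  rw [Matrix.mul_apply]
  refine (norm_sum_le _ _).trans ?_
  calc ∑ l, ‖Bᴴ i l * B l j‖ ≤ ∑ l, (‖B l i‖ ^ 2 / 2 + ‖B l j‖ ^ 2 / 2) := by
        refine Finset.sum_le_sum fun l _ => ?_
        rw [norm_mul, Matrix.conjTranspose_apply, norm_star]
        nlinarith [sq_nonneg (‖B l i‖ - ‖B l j‖)]
    _ ≤ 1 := by
        rw [Finset.sum_add_distrib, ← Finset.sum_div, ← Finset.sum_div]
        linarith [hB i, hB j]

theorem pow_apply_weightMap {N : SuperOp d} {ρ : Matrix d d ℂ} {s : ℝ}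
    (hdb : DetailedBalance s ρ N) (t : ℕ) (B : Matrix d d ℂ) :
    (N ^ t) (weightMap s ρ B) = weightMap s ρ ((dual N ^ t) B) := by
  induction t with
  | zero => simp
  | succ t ih => rw [pow_succ', pow_succ', Module.End.mul_apply, Module.End.mul_apply, ih,
      hdb.apply_weightMap]

theorem tendsto_pow_apply {N : SuperOp d} {ρ : Matrix d d ℂ} {s : ℝ} (hρ : ρ.PosDef)
    (hN : IsChannel N) (hdb : DetailedBalance s ρ N) (hu : UniqueFixedState N ρ)
    (hNspec : spectrum ℂ N ⊆ (fun x : ℝ => (x : ℂ)) '' Set.Icc (0 : ℝ) 1)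
    (X : Matrix d d ℂ) (i j : d) :
    Filter.Tendsto (fun t : ℕ => ((N ^ t) X - X.trace • ρ) i j) Filter.atTop (nhds 0) := by
  obtain ⟨B, rfl⟩ := weightMap_surjective hρ s X
  set τ := (weightMap s ρ B).trace with hτ
  have h1 : (dual N) 1 = 1 := hN.dual_one
  have hpow : ∀ t : ℕ, (dual N ^ t) (1 : Matrix d d ℂ) = 1 := fun t => by
    induction t with
    | zero => simp
    | succ t ih => rw [pow_succ, Module.End.mul_apply, h1, ih]
  -- With X = Γ(B), subtracting τ = tr X times 1 removes the component fixed by N†; what remains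
  -- decays.
  have horth : (weightedCore hρ s).inner 1 (B - τ • 1) = 0 := by
    rw [weightedCore_inner, ← trace_weightMap, map_sub, map_smul, weightMap_one hρ,
      Matrix.trace_sub, Matrix.trace_smul, hu.1.2]
    simp [hτ]
  obtain ⟨hg0, hg1, -⟩ := gap_bounds hNspec
  have := tendsto_functional_pow (weightedCore hρ s) (Q := dual N) (fun x y => (hdb x y).symm) h1
    (sub_nonneg.2 hg1) (by linarith) (abs_eigenvalue_dual_le_or hρ hN hdb hu hNspec) horth
    ((Matrix.entryLinearMap ℂ ℂ i j).comp (weightMap s ρ))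
  refine this.congr fun t => ?_
  rw [pow_apply_weightMap hdb]
  simp only [LinearMap.comp_apply, map_sub, map_smul, hpow, weightMap_one hρ]
  simp

/-- The mixing time is attained. -/
theorem traceNorm_mixingTime_le {N : SuperOp d} {ρ : Matrix d d ℂ} {s : ℝ} (hρ : ρ.PosDef)
    (hN : IsChannel N) (hdb : DetailedBalance s ρ N) (hu : UniqueFixedState N ρ)
    (hNspec : spectrum ℂ N ⊆ (fun x : ℝ => (x : ℂ)) '' Set.Icc (0 : ℝ) 1)
    {η : ℝ} (hη : 0 < η) {σ : Matrix d d ℂ} (hσ : IsState σ) :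
    traceNorm ((N ^ mixingTime N ρ η) σ - ρ) ≤ η := by
  -- The infimum of an empty set of naturals is 0, so the existence of a single uniform time is the
  -- real content.
  suffices h : {t : ℕ | ∀ σ, IsState σ → traceNorm ((N ^ t) σ - ρ) ≤ η}.Nonempty from
    Nat.sInf_mem h σ hσ
  -- A bound independent of the state: expand σ in matrix units, where its coefficients have modulus
  -- at most 1.
  set b : ℕ → d → d → ℝ := fun t k l =>
    ∑ i, ∑ j, ‖((N ^ t) (Matrix.single i j 1) - (Matrix.single i j (1 : ℂ)).trace • ρ) k l‖
  have hb : ∀ k l, Filter.Tendsto (fun t => b t k l) Filter.atTop (nhds 0) := fun k l => by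
    have : Filter.Tendsto (fun t => b t k l) Filter.atTop (nhds (∑ _i : d, ∑ _j : d, (0 : ℝ))) :=
      tendsto_finsetSum _ fun i _ => tendsto_finsetSum _ fun j _ =>
        by simpa using (tendsto_pow_apply hρ hN hdb hu hNspec (Matrix.single i j 1) k l).norm
    simpa using this
  have hlim : Filter.Tendsto
      (fun t => Real.sqrt (Fintype.card d * ∑ k, ∑ l, b t k l ^ 2)) Filter.atTop (nhds 0) := by
    have : Filter.Tendsto (fun t => Real.sqrt (Fintype.card d * ∑ k, ∑ l, b t k l ^ 2))
        Filter.atTop (nhds (Real.sqrt (Fintype.card d * ∑ _k : d, ∑ _l : d, (0 : ℝ) ^ 2))) :=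
      ((tendsto_finsetSum _ fun k _ => tendsto_finsetSum _ fun l _ =>
        (hb k l).pow 2).const_mul _).sqrt
    simpa using this
  obtain ⟨t, ht⟩ := (hlim.eventually (gt_mem_nhds hη)).exists
  refine ⟨t, fun σ hσ => (traceNorm_le_sqrt _).trans (le_trans ?_ ht.le)⟩
  have hexp : (N ^ t) σ - ρ = ∑ i, ∑ j, σ i j •
      ((N ^ t) (Matrix.single i j 1) - (Matrix.single i j (1 : ℂ)).trace • ρ) := by
    have h1 : σ = ∑ i, ∑ j, σ i j • Matrix.single i j (1 : ℂ) := by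
      conv_lhs => rw [Matrix.matrix_eq_sum_single σ]
      simp [Matrix.smul_single]
    have h2 : (∑ i, ∑ j, σ i j * (Matrix.single i j (1 : ℂ)).trace) = 1 := by
      have h3 := congrArg Matrix.trace h1
      rw [hσ.2] at h3
      simp only [Matrix.trace_sum, Matrix.trace_smul, smul_eq_mul] at h3
      exact h3.symm
    simp only [smul_sub, Finset.sum_sub_distrib, smul_smul, ← Finset.sum_smul, h2, one_smul]
    conv_lhs => rw [h1]
    simp only [map_sum, map_smul]
  gcongr with k _ l _
  rw [hexp]
  simp only [Matrix.sum_apply, Matrix.smul_apply, smul_eq_mul]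
  refine (norm_sum_le _ _).trans (Finset.sum_le_sum fun i _ => (norm_sum_le _ _).trans
    (Finset.sum_le_sum fun j _ => ?_))
  rw [norm_mul]
  exact mul_le_of_le_one_left (norm_nonneg _) (norm_apply_le_one_of_isState hσ i j)

namespace Measurement

variable {ι : Type*} [Fintype ι]

/-! ### Measurements -/

theorem isChannel_channel (M : Measurement d ι) : IsChannel M.channel := by
  refine ⟨Fintype.card ι, fun k => M.kraus ((Fintype.equivFin ι).symm k), ?_, ?_⟩
  · rw [(Fintype.equivFin ι).symm.sum_comp fun u => (M.kraus u)ᴴ * M.kraus u]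
    exact M.complete
  · exact ((Fintype.equivFin ι).symm.sum_comp fun u => conjBy (M.kraus u)).symm

theorem channel_apply (M : Measurement d ι) (X : Matrix d d ℂ) :
    M.channel X = ∑ u, conjBy (M.kraus u) X := by
  rw [channel, LinearMap.sum_apply]

theorem hat_apply (M : Measurement d ι) (ρ X : Matrix d d ℂ) :
    M.hat ρ X =
      ∑ u, ((M.outcome u - M.expectation ρ : ℝ) : ℂ) • conjBy (M.kraus u) X := by
  rw [hat, LinearMap.sum_apply]
  rfl

theorem sum_trace_conjBy (M : Measurement d ι) (X : Matrix d d ℂ) :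
    ∑ u, (conjBy (M.kraus u) X).trace.re = X.trace.re := by
  rw [← M.isChannel_channel.trace_apply X, channel_apply, Matrix.trace_sum, Complex.re_sum]

theorem trace_hat_re (M : Measurement d ι) (ρ X : Matrix d d ℂ) :
    (M.hat ρ X).trace.re =
      ∑ u, (M.outcome u - M.expectation ρ) * (conjBy (M.kraus u) X).trace.re := by
  rw [hat_apply, Matrix.trace_sum, Complex.re_sum]
  refine Finset.sum_congr rfl fun u _ => ?_
  rw [Matrix.trace_smul, smul_eq_mul, Complex.re_ofReal_mul]

theorem trace_conjBy_re_nonneg {X : Matrix d d ℂ} (hX : X.PosSemidef) (O : Matrix d d ℂ) :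
    0 ≤ (conjBy O X).trace.re :=
  (Complex.nonneg_iff.1 (posSemidef_conjBy hX O).trace_nonneg).1

theorem trace_hat_self (M : Measurement d ι) {ρ : Matrix d d ℂ} (hρ : IsState ρ) :
    (M.hat ρ ρ).trace = 0 := by
  apply Complex.ext
  · rw [trace_hat_re]
    simp only [sub_mul, Finset.sum_sub_distrib, ← Finset.mul_sum, sum_trace_conjBy, hρ.2]
    simp [expectation]
  · rw [hat_apply, Matrix.trace_sum, Complex.im_sum]
    refine Finset.sum_eq_zero fun u _ => ?_
    rw [Matrix.trace_smul, smul_eq_mul, Complex.im_ofReal_mul,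
      ← (Complex.nonneg_iff.1 (posSemidef_conjBy hρ.1 (M.kraus u)).trace_nonneg).2, mul_zero]

theorem covariance_eq (M : Measurement d ι) (ρ : Matrix d d ℂ) :
    M.covariance ρ = (M.hat ρ (M.hat ρ ρ)).trace.re := by
  rw [trace_hat_re, covariance, Finset.sum_comm]
  refine Finset.sum_congr rfl fun y _ => ?_
  rw [hat_apply, map_sum, Matrix.trace_sum, Complex.re_sum, Finset.mul_sum]
  refine Finset.sum_congr rfl fun x _ => ?_
  rw [map_smul, Matrix.trace_smul, smul_eq_mul, Complex.re_ofReal_mul]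
  ring

theorem variance_eq (M : Measurement d ι) (ρ : Matrix d d ℂ) :
    M.variance ρ =
      ∑ u, (M.outcome u - M.expectation ρ) ^ 2 * (conjBy (M.kraus u) ρ).trace.re := by
  simp only [variance, sq_abs]

theorem variance_nonneg (M : Measurement d ι) {ρ : Matrix d d ℂ} (hρ : ρ.PosSemidef) :
    0 ≤ M.variance ρ :=
  Finset.sum_nonneg fun u _ => mul_nonneg (by positivity) (trace_conjBy_re_nonneg hρ _)

/-- Apply xy ≤ (x² + y²)/2 under the joint law of two successive outcomes, whose two marginals agree
by stationarity. It serves the case of zero variance. -/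
theorem covariance_le_variance (M : Measurement d ι) {ρ : Matrix d d ℂ} (hρ : ρ.PosSemidef)
    (hfix : M.channel ρ = ρ) : M.covariance ρ ≤ M.variance ρ := by
  set f : ι → ℝ := fun u => M.outcome u - M.expectation ρ with hf
  set q : ι → ι → ℝ := fun x y => (conjBy (M.kraus y) (conjBy (M.kraus x) ρ)).trace.re with hq
  have hq0 : ∀ x y, 0 ≤ q x y := fun x y => trace_conjBy_re_nonneg (posSemidef_conjBy hρ _) _
  have h1 : ∀ x, ∑ y, q x y = (conjBy (M.kraus x) ρ).trace.re := fun x => sum_trace_conjBy M _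
  have h2 : ∀ y, ∑ x, q x y = (conjBy (M.kraus y) ρ).trace.re := fun y => by
    conv_rhs => rw [← hfix]
    rw [channel_apply, map_sum, Matrix.trace_sum, Complex.re_sum]
  calc M.covariance ρ = ∑ x, ∑ y, f x * f y * q x y := rfl
    _ ≤ ∑ x, ∑ y, (f x ^ 2 / 2 * q x y + f y ^ 2 / 2 * q x y) := by
      refine Finset.sum_le_sum fun x _ => Finset.sum_le_sum fun y _ => ?_
      rw [← add_mul]
      refine mul_le_mul_of_nonneg_right ?_ (hq0 x y)
      nlinarith [sq_nonneg (f x - f y)]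
    _ = (∑ x, f x ^ 2 / 2 * ∑ y, q x y) + ∑ y, f y ^ 2 / 2 * ∑ x, q x y := by
      simp only [Finset.sum_add_distrib, Finset.mul_sum]
      congr 1
      exact Finset.sum_comm
    _ = M.variance ρ := by
      simp only [h1, h2, variance_eq]
      rw [← Finset.sum_add_distrib]
      refine Finset.sum_congr rfl fun u _ => ?_
      ring

/-! ### Trajectories -/

/-- The linear map underlying `trajectoryState`. -/
def trajectoryMap (M : Measurement d ι) (N : SuperOp d) : List ι → SuperOp d
  | [] => 1
  | u :: l => trajectoryMap M N l * M.channel * N * conjBy (M.kraus u)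

theorem trajectoryState_eq (M : Measurement d ι) (N : SuperOp d) (l : List ι)
    (σ : Matrix d d ℂ) : M.trajectoryState N l σ = M.trajectoryMap N l σ := by
  induction l generalizing σ with
  | nil => rfl
  | cons u l ih => rw [trajectoryState, ih]; rfl

theorem trajectoryProb_sub (M : Measurement d ι) (N : SuperOp d) (A B : Matrix d d ℂ) {K : ℕ}
    (x : Fin K → ι) :
    M.trajectoryProb N (A - B) x = M.trajectoryProb N A x - M.trajectoryProb N B x := by
  simp [trajectoryProb, trajectoryState_eq]

theorem trajectoryProb_sum (M : Measurement d ι) (N : SuperOp d) {κ : Type*} (S : Finset κ)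
    (A : κ → Matrix d d ℂ) {K : ℕ} (x : Fin K → ι) :
    M.trajectoryProb N (∑ k ∈ S, A k) x = ∑ k ∈ S, M.trajectoryProb N (A k) x := by
  simp [trajectoryProb, trajectoryState_eq, Matrix.trace_sum]

theorem posSemidef_trajectoryState (M : Measurement d ι) {N : SuperOp d} (hN : IsChannel N)
    (l : List ι) {σ : Matrix d d ℂ} (hσ : σ.PosSemidef) :
    (M.trajectoryState N l σ).PosSemidef := by
  induction l generalizing σ with
  | nil => exact hσ
  | cons u l ih =>
    exact ih (M.isChannel_channel.posSemidef_apply (hN.posSemidef_apply (posSemidef_conjBy hσ _)))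

theorem trajectoryProb_nonneg (M : Measurement d ι) {N : SuperOp d} (hN : IsChannel N)
    {σ : Matrix d d ℂ} (hσ : σ.PosSemidef) {K : ℕ} (x : Fin K → ι) :
    0 ≤ M.trajectoryProb N σ x :=
  (Complex.nonneg_iff.1 (M.posSemidef_trajectoryState hN _ hσ).trace_nonneg).1

theorem trajectoryProb_cons (M : Measurement d ι) (N : SuperOp d) (σ : Matrix d d ℂ) {K : ℕ}
    (u : ι) (y : Fin K → ι) :
    M.trajectoryProb N σ (Fin.cons u y : Fin (K + 1) → ι) =
      M.trajectoryProb N (M.channel (N (conjBy (M.kraus u) σ))) y := by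
  simp [trajectoryProb, List.ofFn_succ, trajectoryState]

theorem sum_fin_succ_fun {K : ℕ} (F : (Fin (K + 1) → ι) → ℝ) :
    ∑ x, F x = ∑ u, ∑ y : Fin K → ι, F (Fin.cons u y) := by
  rw [← (Fin.consEquiv fun _ : Fin (K + 1) => ι).sum_comp, Fintype.sum_prod_type]
  rfl

theorem trace_channel_comp (M : Measurement d ι) {N : SuperOp d} (hN : IsChannel N)
    (X : Matrix d d ℂ) : (M.channel (N X)).trace = X.trace := by
  rw [M.isChannel_channel.trace_apply, hN.trace_apply]

theorem sum_trajectoryProb (M : Measurement d ι) {N : SuperOp d} (hN : IsChannel N) (K : ℕ)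
    (σ : Matrix d d ℂ) : ∑ x : Fin K → ι, M.trajectoryProb N σ x = σ.trace.re := by
  induction K generalizing σ with
  | zero => simp [trajectoryProb, trajectoryState]
  | succ K ih =>
    simp only [sum_fin_succ_fun, trajectoryProb_cons, ih, M.trace_channel_comp hN,
      sum_trace_conjBy]

/-- The sum of the centred outcomes along a trajectory. -/
def centredSum (M : Measurement d ι) (ρ : Matrix d d ℂ) {K : ℕ} (x : Fin K → ι) : ℝ :=
  ∑ t, (M.outcome (x t) - M.expectation ρ)

theorem centredSum_cons (M : Measurement d ι) (ρ : Matrix d d ℂ) {K : ℕ} (u : ι)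
    (y : Fin K → ι) :
    M.centredSum ρ (Fin.cons u y : Fin (K + 1) → ι) =
      (M.outcome u - M.expectation ρ) + M.centredSum ρ y := by
  simp only [centredSum, Fin.sum_univ_succ, Fin.cons_zero, Fin.cons_succ]

/-- The first moment of the centred sum. -/
theorem sum_centredSum_mul (M : Measurement d ι) {N : SuperOp d} (hN : IsChannel N)
    (ρ : Matrix d d ℂ) (K : ℕ) (σ : Matrix d d ℂ) :
    ∑ x : Fin K → ι, M.centredSum ρ x * M.trajectoryProb N σ x =
      ∑ j ∈ Finset.range K,
        (M.hat ρ (((M.channel * N * M.channel) ^ j) σ)).trace.re := by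
  induction K generalizing σ with
  | zero => simp [centredSum]
  | succ K ih =>
    simp only [sum_fin_succ_fun, trajectoryProb_cons, centredSum_cons, add_mul,
      Finset.sum_add_distrib, ← Finset.mul_sum, M.sum_trajectoryProb hN,
      M.trace_channel_comp hN, ih]
    -- The term j = 0 is the first recorded outcome. In the others, summing over its label restores
    -- the channel M and completes one more factor M N M.
    rw [Finset.sum_range_succ', add_comm, pow_zero, Module.End.one_apply, trace_hat_re M ρ σ,
      Finset.sum_comm]
    congr 1
    refine Finset.sum_congr rfl fun j _ => ?_
    rw [← Complex.re_sum, ← Matrix.trace_sum, ← map_sum, ← map_sum, ← map_sum, ← map_sum,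
      ← channel_apply, pow_succ]
    rfl

/-- The recursion for the second moment of the centred sum at a stationary state. -/
theorem sum_centredSum_sq_mul_succ (M : Measurement d ι) {N : SuperOp d} (hN : IsChannel N)
    {ρ : Matrix d d ℂ} (hM : M.channel ρ = ρ) (hNρ : N ρ = ρ) (K : ℕ) :
    ∑ x : Fin (K + 1) → ι, M.centredSum ρ x ^ 2 * M.trajectoryProb N ρ x =
      M.variance ρ + 2 * (∑ j ∈ Finset.range K, (M.hat ρ (((M.channel * N * M.channel) ^ j)
        (M.channel (N (M.hat ρ ρ))))).trace.re)
      + ∑ x : Fin K → ι, M.centredSum ρ x ^ 2 * M.trajectoryProb N ρ x := by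
  set f : ι → ℝ := fun u => M.outcome u - M.expectation ρ with hf
  set σ : ι → Matrix d d ℂ := fun u => M.channel (N (conjBy (M.kraus u) ρ)) with hσ
  -- Split off the first outcome and expand (f u + S)². The S² part reproduces the K-round moment,
  -- since the states `σ u` sum to ρ; the cross term gives the correlations and f² the variance.
  have h2 : ∑ u, ∑ y : Fin K → ι, M.centredSum ρ y ^ 2 * M.trajectoryProb N (σ u) y =
      ∑ x : Fin K → ι, M.centredSum ρ x ^ 2 * M.trajectoryProb N ρ x := by
    rw [Finset.sum_comm]
    refine Finset.sum_congr rfl fun y _ => ?_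
    rw [← Finset.mul_sum, ← trajectoryProb_sum]
    simp only [hσ]
    rw [← map_sum, ← map_sum, ← channel_apply, hM, hNρ, hM]
  have h1 : ∑ u, f u * ∑ y : Fin K → ι, M.centredSum ρ y * M.trajectoryProb N (σ u) y =
      ∑ j ∈ Finset.range K, (M.hat ρ (((M.channel * N * M.channel) ^ j)
        (M.channel (N (M.hat ρ ρ))))).trace.re := by
    simp only [M.sum_centredSum_mul hN, Finset.mul_sum]
    rw [Finset.sum_comm]
    refine Finset.sum_congr rfl fun j _ => ?_
    conv_rhs => rw [M.hat_apply ρ ρ]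
    simp only [map_sum, map_smul, Matrix.trace_sum, Complex.re_sum, Matrix.trace_smul,
      smul_eq_mul, Complex.re_ofReal_mul]
    rfl
  have h0 : ∑ u, f u ^ 2 * ∑ y : Fin K → ι, M.trajectoryProb N (σ u) y = M.variance ρ := by
    simp only [M.sum_trajectoryProb hN, hσ, M.trace_channel_comp hN, variance_eq, hf]
  rw [← h0, ← h1, ← h2, sum_fin_succ_fun, Finset.mul_sum, ← Finset.sum_add_distrib,
    ← Finset.sum_add_distrib]
  refine Finset.sum_congr rfl fun u _ => ?_
  rw [Finset.mul_sum, Finset.mul_sum, Finset.mul_sum, ← Finset.sum_add_distrib,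
    ← Finset.sum_add_distrib]
  refine Finset.sum_congr rfl fun y _ => ?_
  rw [trajectoryProb_cons, centredSum_cons]
  ring

theorem sum_centredSum_sq_mul_le (M : Measurement d ι) {N : SuperOp d} (hN : IsChannel N)
    {ρ : Matrix d d ℂ} (hM : M.channel ρ = ρ) (hNρ : N ρ = ρ) {b : ℝ}
    (hb : ∀ K : ℕ, ∑ j ∈ Finset.range K, (M.hat ρ (((M.channel * N * M.channel) ^ j)
        (M.channel (N (M.hat ρ ρ))))).trace.re ≤ b) (K : ℕ) :
    ∑ x : Fin K → ι, M.centredSum ρ x ^ 2 * M.trajectoryProb N ρ x ≤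
      K * (M.variance ρ + 2 * b) := by
  induction K with
  | zero => simp [centredSum]
  | succ K ih =>
    rw [M.sum_centredSum_sq_mul_succ hN hM hNρ]
    push_cast
    linarith [hb K]

/-! ### Correlations under detailed balance -/

theorem trace_hat_weightMap (M : Measurement d ι) (s : ℝ) (ρ Y : Matrix d d ℂ) :
    (M.hat ρ (weightMap s ρ Y)).trace = weightedInner s ρ (dual (M.hat ρ) 1) Y := by
  rw [trace_eq_hsInner, hsInner_conj, weightedInner_eq_hsInner]

theorem hat_self_eq (M : Measurement d ι) {s : ℝ} {ρ : Matrix d d ℂ} (hρ : ρ.PosDef)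
    (hMhat : DetailedBalance s ρ (M.hat ρ)) :
    M.hat ρ ρ = weightMap s ρ (dual (M.hat ρ) 1) := by
  rw [← hMhat.apply_weightMap, weightMap_one hρ]

/-- One M̂ acts on the state and yields Γ(a); the other, under the trace, is pairing with a =
M̂†(1). So the covariance is a squared norm. -/
theorem covariance_eq_weightedInner (M : Measurement d ι) {s : ℝ} {ρ : Matrix d d ℂ}
    (hρ : ρ.PosDef) (hMhat : DetailedBalance s ρ (M.hat ρ)) :
    M.covariance ρ = (weightedInner s ρ (dual (M.hat ρ) 1) (dual (M.hat ρ) 1)).re := by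
  rw [covariance_eq, M.hat_self_eq hρ hMhat, trace_hat_weightMap]

theorem covariance_nonneg (M : Measurement d ι) {s : ℝ} {ρ : Matrix d d ℂ}
    (hρ : ρ.PosDef) (hMhat : DetailedBalance s ρ (M.hat ρ)) : 0 ≤ M.covariance ρ := by
  rw [M.covariance_eq_weightedInner hρ hMhat]
  exact (weightedCore hρ s).re_inner_nonneg _

/-- Pulling Γ out through every channel leaves a weighted inner product of a with its Heisenberg
evolution. The zero mean of the centred outcome is exactly a ⊥ 1, so `norm_correlation_le` applies.
-/
theorem correlation_le (M : Measurement d ι) {N : SuperOp d} {s : ℝ} {ρ : Matrix d d ℂ}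
    (hρ : ρ.PosDef) (hN : IsChannel N) (hNdb : DetailedBalance s ρ N)
    (hMdb : DetailedBalance s ρ M.channel) (hu : UniqueFixedState N ρ)
    (hNspec : spectrum ℂ N ⊆ (fun x : ℝ => (x : ℂ)) '' Set.Icc (0 : ℝ) 1)
    (hMhat : DetailedBalance s ρ (M.hat ρ)) (j : ℕ) :
    (M.hat ρ (((M.channel * N * M.channel) ^ j) (M.channel (N (M.hat ρ ρ))))).trace.re ≤
      (1 - gap N) ^ (j + 1) * M.covariance ρ := by
  set a := dual (M.hat ρ) 1 with ha
  have hMN : ∀ (k : ℕ) (Y : Matrix d d ℂ),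
      ((M.channel * N * M.channel) ^ k) (weightMap s ρ Y) =
        weightMap s ρ (((dual M.channel * dual N * dual M.channel) ^ k) Y) := by
    intro k Y
    induction k with
    | zero => simp
    | succ k ih =>
      rw [pow_succ', pow_succ']
      simp only [Module.End.mul_apply] at ih ⊢
      rw [ih, hMdb.apply_weightMap, hNdb.apply_weightMap, hMdb.apply_weightMap]
  rw [M.hat_self_eq hρ hMhat, hNdb.apply_weightMap, hMdb.apply_weightMap, hMN,
    trace_hat_weightMap, M.covariance_eq_weightedInner hρ hMhat, ← ha]
  have hM1 := M.isChannel_channel.dual_one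
  have horth : (weightedCore hρ s).inner 1 a = 0 := by
    rw [weightedCore_inner, ← trace_weightMap, ← M.hat_self_eq hρ hMhat, M.trace_hat_self hu.1]
  exact (Complex.re_le_norm _).trans
    (norm_correlation_le (weightedCore hρ s) (fun x y => (hMdb x y).symm)
      (fun x y => (hNdb x y).symm) hM1 hN.dual_one (sub_nonneg.2 (gap_bounds hNspec).2.1)
      (fun μ X hX h => M.isChannel_channel.abs_eigenvalue_dual_le_one hρ
        (hMdb.apply_eq_self hρ hM1) hX h)
      (abs_eigenvalue_dual_le_or hρ hN hNdb hu hNspec) horth j)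

theorem sum_correlation_le (M : Measurement d ι) {N : SuperOp d} {s : ℝ} {ρ : Matrix d d ℂ}
    (hρ : ρ.PosDef) (hN : IsChannel N) (hNdb : DetailedBalance s ρ N)
    (hMdb : DetailedBalance s ρ M.channel) (hu : UniqueFixedState N ρ)
    (hNspec : spectrum ℂ N ⊆ (fun x : ℝ => (x : ℂ)) '' Set.Icc (0 : ℝ) 1)
    (hMhat : DetailedBalance s ρ (M.hat ρ)) (K : ℕ) :
    ∑ j ∈ Finset.range K, (M.hat ρ (((M.channel * N * M.channel) ^ j)
        (M.channel (N (M.hat ρ ρ))))).trace.re ≤ M.covariance ρ / gap N := by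
  obtain ⟨hg0, hg1, -⟩ := gap_bounds hNspec
  have hcov := M.covariance_nonneg hρ hMhat
  -- Dropping one factor 1 - gap relaxes the limit (1 - gap)/gap of the geometric sum to 1/gap.
  calc _ ≤ ∑ j ∈ Finset.range K, (1 - gap N) ^ j * M.covariance ρ :=
        Finset.sum_le_sum fun j _ =>
          (M.correlation_le hρ hN hNdb hMdb hu hNspec hMhat j).trans
            (mul_le_mul_of_nonneg_right
              (pow_le_pow_of_le_one (by linarith) (by linarith) j.le_succ) hcov)
    _ = (∑ j ∈ Finset.range K, (1 - gap N) ^ j) * M.covariance ρ := by rw [Finset.sum_mul]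
    _ ≤ (1 / gap N) * M.covariance ρ := by
      refine mul_le_mul_of_nonneg_right ?_ hcov
      rw [le_div_iff₀ hg0]
      have := geom_sum_mul (1 - gap N) K
      have h2 : 0 ≤ (1 - gap N) ^ K := pow_nonneg (by linarith) K
      linarith
    _ = M.covariance ρ / gap N := by ring

/-! ### Deviation probabilities -/

/-- Deviation probabilities of two initial states differ by at most their trace distance. -/
theorem deviation_sub_le (M : Measurement d ι) {N : SuperOp d} (hN : IsChannel N)
    {σ ρ : Matrix d d ℂ} (hσ : σ.IsHermitian) (hρ : ρ.IsHermitian) {K : ℕ}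
    (S : Finset (Fin K → ι)) :
    ∑ x ∈ S, M.trajectoryProb N σ x ≤
      ∑ x ∈ S, M.trajectoryProb N ρ x + traceNorm (σ - ρ) := by
  -- The negative part only lowers the probability, and the positive part contributes at most its
  -- trace.
  obtain ⟨B, C, hB, hC, h, htr⟩ := exists_posSemidef_sub (hσ.sub hρ)
  have h1 : ∑ x ∈ S, M.trajectoryProb N σ x - ∑ x ∈ S, M.trajectoryProb N ρ x =
      ∑ x ∈ S, M.trajectoryProb N B x - ∑ x ∈ S, M.trajectoryProb N C x := by
    simp only [← Finset.sum_sub_distrib, ← trajectoryProb_sub, h]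
  have h2 : ∑ x ∈ S, M.trajectoryProb N B x ≤ B.trace.re := by
    rw [← M.sum_trajectoryProb hN K]
    exact Finset.sum_le_sum_of_subset_of_nonneg (Finset.subset_univ _)
      fun x _ _ => M.trajectoryProb_nonneg hN hB x
  have h3 : 0 ≤ ∑ x ∈ S, M.trajectoryProb N C x :=
    Finset.sum_nonneg fun x _ => M.trajectoryProb_nonneg hN hC x
  linarith

open Classical in
/-- Chebyshev's inequality for the empirical average. -/
theorem chebyshev (M : Measurement d ι) {N : SuperOp d} (hN : IsChannel N)
    {ρ : Matrix d d ℂ} (hρ : ρ.PosSemidef) {K : ℕ} (hK : 1 ≤ K) {ε : ℝ} (hε : 0 < ε) :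
    ∑ x : Fin K → ι with ε ≤ |M.empiricalAverage x - M.expectation ρ|, M.trajectoryProb N ρ x ≤
      (∑ x : Fin K → ι, M.centredSum ρ x ^ 2 * M.trajectoryProb N ρ x) / (K * ε) ^ 2 := by
  have hK0 : (0 : ℝ) < K := by exact_mod_cast hK
  rw [le_div_iff₀ (by positivity), Finset.sum_mul]
  refine (Finset.sum_le_sum (g := fun x => M.centredSum ρ x ^ 2 * M.trajectoryProb N ρ x)
    fun x hx => ?_).trans
    (Finset.sum_le_sum_of_subset_of_nonneg (Finset.subset_univ _)
      fun x _ _ => mul_nonneg (sq_nonneg _) (M.trajectoryProb_nonneg hN hρ x))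
  rw [mul_comm]
  refine mul_le_mul_of_nonneg_right ?_ (M.trajectoryProb_nonneg hN hρ x)
  have h1 : M.centredSum ρ x = K * (M.empiricalAverage x - M.expectation ρ) := by
    rw [centredSum, Finset.sum_sub_distrib, empiricalAverage]
    field_simp
    simp
  rw [h1, ← sq_abs (_ * (_ - _)), abs_mul, abs_of_pos hK0]
  have := (Finset.mem_filter.1 hx).2
  gcongr

end Measurement

/-- The sampling guarantee with respect to an arbitrary faithful stationary state. -/
theorem Measurement.deviationProb_mixingTime_le {d ι : Type*} [Fintype d] [DecidableEq d]
    [Fintype ι] {s : ℝ} {r : Matrix d d ℂ} (hr : r.PosDef) {N : SuperOp d}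
    (M : Measurement d ι) (hN : IsChannel N) (hNdb : DetailedBalance s r N)
    (hMdb : DetailedBalance s r M.channel) (hNfix : UniqueFixedState N r)
    (hNspec : spectrum ℂ N ⊆ (fun x : ℝ => (x : ℂ)) '' Set.Icc (0 : ℝ) 1)
    (hMhat : DetailedBalance s r (M.hat r)) {ρ : Matrix d d ℂ} (hρ : IsState ρ)
    {ε η : ℝ} (hε : 0 < ε) (hη : 0 < η) {K : ℕ} (hK1 : 1 ≤ K)
    (hK : 2 * M.variance r / (ε ^ 2 * η) *
      (1 / gap N * (M.covariance r / M.variance r) + 1 / 2) ≤ (K : ℝ)) :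
    M.deviationProb N ρ (mixingTime N r η) K (M.expectation r) ε ≤ 2 * η := by
  have hMfix : M.channel r = r := hMdb.apply_eq_self hr M.isChannel_channel.dual_one
  obtain ⟨hg0, -, -⟩ := gap_bounds hNspec
  have hK0 : (0 : ℝ) < K := by exact_mod_cast hK1
  have hstat : M.variance r + 2 * (M.covariance r / gap N) ≤ K * (ε ^ 2 * η) := by
    -- At zero variance the quotient in `hK` is 0 by convention and carries no information, but then
    -- 0 ≤ Cov ≤ V forces Cov = 0.
    rcases (M.variance_nonneg hr.posSemidef).eq_or_lt with hV | hV
    · have hC : M.covariance r = 0 :=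
        le_antisymm (hV ▸ M.covariance_le_variance hr.posSemidef hMfix)
          (M.covariance_nonneg hr hMhat)
      rw [← hV, hC, zero_div, mul_zero, add_zero]
      positivity
    · rw [div_mul_eq_mul_div, div_le_iff₀ (by positivity)] at hK
      refine le_of_eq_of_le ?_ hK
      field_simp
      ring
  have hmix := traceNorm_mixingTime_le hr hN hNdb hNfix hNspec hη hρ
  have hcheb := (M.chebyshev hN hr.posSemidef hK1 hε).trans
    (div_le_div_of_nonneg_right (M.sum_centredSum_sq_mul_le hN hMfix hNfix.2.1
      (M.sum_correlation_le hr hN hNdb hMdb hNfix hNspec hMhat) K) (sq_nonneg _))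
  have hη' : K * (M.variance r + 2 * (M.covariance r / gap N)) / (K * ε) ^ 2 ≤ η := by
    rw [div_le_iff₀ (by positivity)]
    calc (K : ℝ) * (M.variance r + 2 * (M.covariance r / gap N))
        ≤ K * (K * (ε ^ 2 * η)) := by gcongr
      _ = η * (K * ε) ^ 2 := by ring
  rw [Measurement.deviationProb]
  refine (M.deviation_sub_le hN (hN.isState_pow_apply hρ _).1.1 hr.1 _).trans ?_
  linarith

end

end SingleTrajectory

/-- The Gibbs state enters only as a faithful stationary state. -/
theorem theorem5p3 {d ι : Type*} [Fintype d] [DecidableEq d] [Fintype ι]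
    (H : Matrix d d ℂ) (hH : H.IsHermitian) (β : ℝ) (s : ℝ) (hs : s ∈ Set.Icc (0 : ℝ) 1)
    (N : SingleTrajectory.SuperOp d) (M : SingleTrajectory.Measurement d ι)
    (hN : SingleTrajectory.IsChannel N)
    (hNdb : SingleTrajectory.DetailedBalance s (SingleTrajectory.gibbs H β) N)
    (hMdb : SingleTrajectory.DetailedBalance s (SingleTrajectory.gibbs H β) M.channel)
    (hNfix : SingleTrajectory.UniqueFixedState N (SingleTrajectory.gibbs H β))
    (hNspec : spectrum ℂ N ⊆ (fun x : ℝ => (x : ℂ)) '' Set.Icc (0 : ℝ) 1)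
    (hMhat : SingleTrajectory.DetailedBalance s (SingleTrajectory.gibbs H β)
      (M.hat (SingleTrajectory.gibbs H β)))
    (ρ : Matrix d d ℂ) (hρ : SingleTrajectory.IsState ρ)
    (ε η : ℝ) (hε : 0 < ε) (hη : 0 < η) (K : ℕ) (hK1 : 1 ≤ K)
    (hK : 2 * M.variance (SingleTrajectory.gibbs H β) / (ε ^ 2 * η) *
        (1 / SingleTrajectory.gap N *
          (M.covariance (SingleTrajectory.gibbs H β) / M.variance (SingleTrajectory.gibbs H β))
          + 1 / 2) ≤ (K : ℝ)) :
    M.deviationProb N ρ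
      (SingleTrajectory.mixingTime N (SingleTrajectory.gibbs H β) η) K
      (M.expectation (SingleTrajectory.gibbs H β)) ε ≤ 2 * η := by
  exact M.deviationProb_mixingTime_le (SingleTrajectory.posDef_gibbs hNfix.1) hN hNdb hMdb hNfix
    hNspec hMhat hρ hε hη hK1 hK
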